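/- Let $n\ge 1$. Let $\mathcal K_{2n}=\{x_{2i-1}-x_{2j}=0 : 1\le i\le j\le n\}$, a hyperplane arrangement in $\mathbb R^{2n+1}$, and let $\mathcal R(\mathcal K_{2n})$ be its set of regions, i.e. of connected components of the complement of the union of its hyperplanes. A permutation $\pi$ of $[2n]=\{1,\dots,2n\}$ is \emph{compatible} with a region $R$ if for all $a<b$ in $[2n]$ with $a$ odd and $b$ even, and all $\mathbf x\in R$, one has $\pi^{-1}(a)<\pi^{-1}(b)$ if and only if $x_a<x_b$. Write $\sigma=\sigma_1\cdots\sigma_{2n}$ in one-line notation. A parity pattern is a consecutive pair $\sigma_i\sigma_{i+1}$ with prescribed parities and order: the letters $\mathrm e,\mathrm o$ stand for even and odd, and the capital marks the larger entry (so $\mathrm{eO}$ is an ascent $\sigma_i<\sigma_{i+1}$ with $\sigma_i$ even and $\sigma_{i+1}$ odd, and $\mathrm{Oe}$ is a descent $\sigma_i>\sigma_{i+1}$ with $\sigma_i$ odd and $\sigma_{i+1}$ even). For $d\ge 0$ and $j=i+d+1$, let $\alpha=\sigma_{i+1}\cdots\sigma_{j-1}$. The pair $(\sigma_i,\sigma_j)$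 forms - an $\mathrm{eO}_d$ pattern if $\sigma_i$ is even, $\sigma_{i+1},\dots,\sigma_j$ are all odd, and $\sigma_i<\sigma_j$; - an $\mathrm{Oo}_d$ pattern if $\sigma_i,\sigma_j$ are odd, all letters of $\alpha$ are even, and $\sigma_i>\sigma_j$ if $d=0$, $\sigma_i>\max(\alpha)>\sigma_j$ if $d>0$; - an $\mathrm{Ee}_d$ pattern if $\sigma_i,\sigma_j$ are even, all letters of $\alpha$ are odd, and $\sigma_i>\sigma_j$ if $d=0$, $\sigma_i>\min(\alpha)>\sigma_j$ if $d>0$. Define three sets of permutations of $[2n]$: - $\mathfrak G^{\mathrm{II}}_{2n}$: those $\sigma$ that avoid $\mathrm{Ee},\mathrm{eO},\mathrm{oO}$ and in which every $\mathrm{Oe}$ pattern $(\sigma_m,\sigma_{m+1})$ is initial, i.e. $\sigma_1>\cdots>\sigma_m>\sigma_{m+1}$ and $\sigma_1,\dots,\sigma_m$ are all odd; - $\mathfrak G^{\mathrm{III}}_{2n}$: those that avoid $\mathrm{Oo}$, $\mathrm{eE}$, and $\mathrm{eO}_d$ for every $d\ge 0$; - $\mathfrak G^{\mathrm{IV}}_{2n}$: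 those that avoid $\mathrm{eO}$, and $\mathrm{Oo}_d$ and $\mathrm{Ee}_d$ for every $d\ge 0$. Then for each $\mathrm X\in\{\mathrm{II},\mathrm{III},\mathrm{IV}\}$, every region $R\in\mathcal R(\mathcal K_{2n})$ is compatible with exactly one permutation $\Lambda^{\mathrm X}(R)\in\mathfrak G^{\mathrm X}_{2n}$, and the resulting labeling $$\Lambda^{\mathrm X}:\mathcal R(\mathcal K_{2n})\to\mathfrak G^{\mathrm X}_{2n}$$ is a bijection. -/

import Mathlib

namespace ParityPattern

/-! ### The arrangement and its regions -/

/-- The hyperplanes `x_{2i-1} - x_{2j} = 0`, `1 ≤ i ≤ j ≤ n`, in `ℝ^{2n+1}`.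
The coordinate `x_k`, `1 ≤ k ≤ 2n+1`, is the value at the index `k - 1`. -/
def arrangement (n : ℕ) : Set (Set (Fin (2 * n + 1) → ℝ)) :=
  {H | ∃ (i j : ℕ) (_ : 1 ≤ i) (_ : i ≤ j) (_ : j ≤ n),
    H = {x | x ⟨2 * i - 1 - 1, by omega⟩ - x ⟨2 * j - 1, by omega⟩ = 0}}

/-- The complement of the union of all the hyperplanes. -/
def arrangementCompl (n : ℕ) : Set (Fin (2 * n + 1) → ℝ) :=
  (⋃₀ arrangement n)ᶜ

/-- The regions: the connected components of the complement of the arrangement. -/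
def regions (n : ℕ) : Set (Set (Fin (2 * n + 1) → ℝ)) :=
  {R | ∃ x ∈ arrangementCompl n, R = connectedComponentIn (arrangementCompl n) x}

/-! ### Parity patterns

A permutation of `[m]` is a permutation `σ` of `Fin m`; its one-line notation
`σ_1 σ_2 ⋯ σ_m` has `letter σ i` in the position numbered `i + 1`. -/

/-- The letter, in `{1, …, m}`, at the position `i`. -/
def letter {m : ℕ} (σ : Equiv.Perm (Fin m)) (i : Fin m) : ℕ := (σ i : ℕ) + 1

/-- The positions `i, j` are adjacent and carry an ascent whose first letter satisfies `P` and
whose second letter satisfies `Q`; e.g. `eO` is the case `P = Even`, `Q = Odd`. -/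
def AscentAt {m : ℕ} (P Q : ℕ → Prop) (σ : Equiv.Perm (Fin m)) (i j : Fin m) : Prop :=
  (j : ℕ) = i + 1 ∧ P (letter σ i) ∧ Q (letter σ j) ∧ letter σ i < letter σ j

/-- The positions `i, j` are adjacent and carry a descent whose first letter satisfies `P` and
whose second letter satisfies `Q`; e.g. `Oe` is the case `P = Odd`, `Q = Even`. -/
def DescentAt {m : ℕ} (P Q : ℕ → Prop) (σ : Equiv.Perm (Fin m)) (i j : Fin m) : Prop :=
  (j : ℕ) = i + 1 ∧ P (letter σ i) ∧ Q (letter σ j) ∧ letter σ i > letter σ j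

/-- The positions `i, j` carry an `eO` pattern at distance `d`. -/
def eOAt {m : ℕ} (d : ℕ) (σ : Equiv.Perm (Fin m)) (i j : Fin m) : Prop :=
  (j : ℕ) = i + d + 1 ∧
  (Even (letter σ i) ∧ ∀ l, i < l → l ≤ j → Odd (letter σ l)) ∧
  letter σ i < letter σ j

/-- The positions `i, j` carry an `Oo` pattern at distance `d`: with `α` the factor strictly
between them, `α` is even, of length `d`, and `σ_i > σ_j` if `d = 0`, while
`σ_i > max α > σ_j` if `d > 0`. -/
def OoAt {m : ℕ} (d : ℕ) (σ : Equiv.Perm (Fin m)) (i j : Fin m) : Prop :=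
  (j : ℕ) = i + d + 1 ∧
  Odd (letter σ i) ∧ Odd (letter σ j) ∧ (∀ l, i < l → l < j → Even (letter σ l)) ∧
  (d = 0 → letter σ i > letter σ j) ∧
  (0 < d → (∀ l, i < l → l < j → letter σ i > letter σ l) ∧
    ∃ l, i < l ∧ l < j ∧ letter σ l > letter σ j)

/-- The positions `i, j` carry an `Ee` pattern at distance `d`: with `α` the factor strictly
between them, `α` is odd, of length `d`, and `σ_i > σ_j` if `d = 0`, while
`σ_i > min α > σ_j` if `d > 0`. -/
def EeAt {m : ℕ} (d : ℕ) (σ : Equiv.Perm (Fin m)) (i j : Fin m) : Prop :=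
  (j : ℕ) = i + d + 1 ∧
  Even (letter σ i) ∧ Even (letter σ j) ∧ (∀ l, i < l → l < j → Odd (letter σ l)) ∧
  (d = 0 → letter σ i > letter σ j) ∧
  (0 < d → (∃ l, i < l ∧ l < j ∧ letter σ i > letter σ l) ∧
    ∀ l, i < l → l < j → letter σ l > letter σ j)

/-! ### The three sets of permutations of `[2n]` -/

/-- Avoiding `Ee`, `eO`, `oO`, and having no `Oe` but an initial one: everything up to the odd
letter of the `Oe` is odd, and the word decreases up to and including the even letter. -/
def GII (n : ℕ) : Set (Equiv.Perm (Fin (2 * n))) :=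
  {σ | (∀ i j, ¬ DescentAt Even Even σ i j) ∧
    (∀ i j, ¬ AscentAt Even Odd σ i j) ∧
    (∀ i j, ¬ AscentAt Odd Odd σ i j) ∧
    ∀ i j, DescentAt Odd Even σ i j →
      (∀ l, l ≤ i → Odd (letter σ l)) ∧
      ∀ l l', l < l' → l' ≤ j → letter σ l > letter σ l'}

/-- Avoiding `Oo`, `eE`, and `eO` at every distance. -/
def GIII (n : ℕ) : Set (Equiv.Perm (Fin (2 * n))) :=
  {σ | (∀ i j, ¬ DescentAt Odd Odd σ i j) ∧
    (∀ i j, ¬ AscentAt Even Even σ i j) ∧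
    ∀ d i j, ¬ eOAt d σ i j}

/-- Avoiding `eO`, and `Oo` and `Ee` at every distance. -/
def GIV (n : ℕ) : Set (Equiv.Perm (Fin (2 * n))) :=
  {σ | (∀ i j, ¬ AscentAt Even Odd σ i j) ∧
    (∀ d i j, ¬ OoAt d σ i j) ∧
    ∀ d i j, ¬ EeAt d σ i j}

/-- `π` is compatible with `R`: for every pair of letters `a + 1 < b + 1` in `[2n]`, the first
odd and the second even, and every `x ∈ R`, the letter `a + 1` precedes `b + 1` in `π` if and
only if `x_{a+1} < x_{b+1}`. -/
def Compatible {n : ℕ} (π : Equiv.Perm (Fin (2 * n))) (R : Set (Fin (2 * n + 1) → ℝ)) : Prop :=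
  ∀ a b : Fin (2 * n), a < b → Odd ((a : ℕ) + 1) → Even ((b : ℕ) + 1) →
    ∀ x ∈ R, (π.symm a < π.symm b ↔ x a.castSucc < x b.castSucc)

/-- `Λ` labels the regions by the elements of `G`: it is a bijection, and the label of a region
is the one and only element of `G` that is compatible with the region. -/
def IsLabeling {n : ℕ} (G : Set (Equiv.Perm (Fin (2 * n)))) (Λ : regions n → G) : Prop :=
  Function.Bijective Λ ∧
  ∀ (R : regions n) (π : G), Compatible (π : Equiv.Perm (Fin (2 * n))) (R : Set _) ↔ π = Λ R

end ParityPattern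

/-! Join two letters when the smaller is odd and the larger even, which is when their coordinates
share a hyperplane. A point off the arrangement orders each linked pair. Two points lie in the same
region exactly when these orders agree: a connected set off the arrangement cannot change the sign
of a difference, and the segment between two points with equal signs meets no hyperplane. Positions
in a permutation are themselves coordinates of such a point, so regions correspond to classes of
permutations under `SameOrder Linked`. It remains to find exactly one member of each class in each
of the three sets (`exists_isLabeling`).

A class is stable under commuting neighbouring unlinked letters. For types II and III the
representative is the lexicographically least word of its class for a suitable ranking of the
letters (`rankII`, `rankIII`). Such words are recognised by having no letter that could be commuted
in front of one of larger rank, and the parity patterns spell out the minimal obstructions.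

For type IV the pattern conditions become separation conditions on descents (`IsBlockNormal`). A
representative is a word of increasing blocks of alternating parity: even letters sit at their
level, the length of the longest chain of linked predecessors up to a parity offset, and odd letters
are delayed until just before a block with a larger even letter. Uniqueness follows by comparing two
words at their first difference. -/

namespace ParityPattern

/-! ### Linked letters and order classes of permutations. -/

/-- The letters `a + 1` and `b + 1` are coordinates of a common hyperplane: the smaller one is odd
and the larger one is even. -/
def Linked {m : ℕ} (a b : Fin m) : Prop :=
  ((a : ℕ) % 2 = 0 ∧ (b : ℕ) % 2 = 1 ∧ (a : ℕ) < b) ∨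
    ((b : ℕ) % 2 = 0 ∧ (a : ℕ) % 2 = 1 ∧ (b : ℕ) < a)

theorem Linked.symm {m : ℕ} {a b : Fin m} (h : Linked a b) : Linked b a := Or.symm h

theorem Linked.ne {m : ℕ} {a b : Fin m} (h : Linked a b) : a ≠ b := by
  rintro rfl
  unfold Linked at h
  omega

/-- Two permutations list all pairs of related letters in the same order. -/
def SameOrder {m : ℕ} (D : Fin m → Fin m → Prop) (σ τ : Equiv.Perm (Fin m)) : Prop :=
  ∀ a b, D a b → (σ.symm a < σ.symm b ↔ τ.symm a < τ.symm b)

theorem SameOrder.symm {m : ℕ} {D : Fin m → Fin m → Prop} {σ τ : Equiv.Perm (Fin m)}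
    (h : SameOrder D σ τ) : SameOrder D τ σ := fun a b hab => (h a b hab).symm

theorem SameOrder.trans {m : ℕ} {D : Fin m → Fin m → Prop} {σ τ ρ : Equiv.Perm (Fin m)}
    (h : SameOrder D σ τ) (h' : SameOrder D τ ρ) : SameOrder D σ ρ :=
  fun a b hab => (h a b hab).trans (h' a b hab)

/-- An injective key on the letters is listed in increasing order by some permutation. -/
theorem exists_perm_symm_lt_iff {m : ℕ} {α : Type*} [LinearOrder α] (f : Fin m → α)
    (hf : Function.Injective f) :
    ∃ τ : Equiv.Perm (Fin m), ∀ a b, τ.symm a < τ.symm b ↔ f a < f b := by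
  refine ⟨Tuple.sort f, fun a b => ?_⟩
  have hs : StrictMono (f ∘ Tuple.sort f) :=
    (Tuple.monotone_sort f).strictMono_of_injective (hf.comp (Tuple.sort f).injective)
  have := hs.lt_iff_lt (a := (Tuple.sort f).symm a) (b := (Tuple.sort f).symm b)
  simpa using this.symm

/-! ### Regions correspond to order classes. -/

/-- The permutation `π` lists the linked letters in the order of the coordinates of `x`. -/
def Sorts {n : ℕ} (π : Equiv.Perm (Fin (2 * n))) (x : Fin (2 * n + 1) → ℝ) : Prop :=
  ∀ a b : Fin (2 * n), a < b → Odd ((a : ℕ) + 1) → Even ((b : ℕ) + 1) →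
    (π.symm a < π.symm b ↔ x a.castSucc < x b.castSucc)

theorem mem_arrangementCompl {n : ℕ} {x : Fin (2 * n + 1) → ℝ} :
    x ∈ arrangementCompl n ↔ ∀ a b : Fin (2 * n), a < b → Odd ((a : ℕ) + 1) →
      Even ((b : ℕ) + 1) → x a.castSucc ≠ x b.castSucc := by
  constructor
  · intro hx a b hab ha hb he
    -- These indices solve `a + 1 = 2i - 1` and `b + 1 = 2j`.
    refine hx ⟨_, ⟨((a : ℕ) + 2) / 2, ((b : ℕ) + 1) / 2, ?_, ?_, ?_, rfl⟩, ?_⟩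
    · omega
    · have : (a : ℕ) < b := hab
      rw [Nat.odd_iff] at ha
      rw [Nat.even_iff] at hb
      omega
    · omega
    · rw [Nat.odd_iff] at ha
      rw [Nat.even_iff] at hb
      have h1 : (⟨2 * (((a : ℕ) + 2) / 2) - 1 - 1, by omega⟩ : Fin (2 * n + 1)) = a.castSucc := by
        apply Fin.ext
        simp only [Fin.val_castSucc]
        omega
      have h2 : (⟨2 * (((b : ℕ) + 1) / 2) - 1, by omega⟩ : Fin (2 * n + 1)) = b.castSucc := by
        apply Fin.ext
        simp only [Fin.val_castSucc]
        omega
      simp only [Set.mem_ofPred_eq, h1, h2, he, sub_self]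
  · rintro h ⟨H, ⟨i, j, hi, hij, hj, rfl⟩, hx⟩
    refine h ⟨2 * i - 1 - 1, by omega⟩ ⟨2 * j - 1, by omega⟩ ?_ ?_ ?_ (sub_eq_zero.mp hx)
    · rw [Fin.lt_def]
      simp only
      omega
    · rw [Nat.odd_iff]
      simp only
      omega
    · rw [Nat.even_iff]
      simp only
      omega

theorem exists_sorts {n : ℕ} {x : Fin (2 * n + 1) → ℝ} (hx : x ∈ arrangementCompl n) :
    ∃ π, Sorts π x := by
  -- The second component breaks ties, which off the arrangement occur only between unlinked
  -- coordinates.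
  obtain ⟨τ, hτ⟩ := exists_perm_symm_lt_iff
    (fun a : Fin (2 * n) => toLex (x a.castSucc, a)) (by
      intro a b hab
      simpa using congrArg (fun p => (ofLex p).2) hab)
  refine ⟨τ, fun a b hab ha hb => ?_⟩
  rw [hτ, Prod.Lex.toLex_lt_toLex]
  have := mem_arrangementCompl.mp hx a b hab ha hb
  simp [this]

theorem exists_point_sorts {n : ℕ} (π : Equiv.Perm (Fin (2 * n))) :
    ∃ x ∈ arrangementCompl n, Sorts π x := by
  -- Each letter's coordinate is its position; the last coordinate lies on no hyperplane, so its
  -- value is arbitrary.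
  refine ⟨fun k => if h : (k : ℕ) < 2 * n then ((π.symm ⟨k, h⟩ : ℕ) : ℝ) else 0, ?_, ?_⟩
  · rw [mem_arrangementCompl]
    intro a b hab _ _ he
    simp only [Fin.val_castSucc, Fin.is_lt, dite_true, Fin.eta, Nat.cast_inj] at he
    exact hab.ne (π.symm.injective (Fin.ext he))
  · intro a b _ _ _
    simp

/-- By the intermediate value theorem, a change of sign of the difference would put a zero of it
inside the component. -/
theorem lt_iff_of_mem_connectedComponentIn {n : ℕ} {x y : Fin (2 * n + 1) → ℝ}
    (hx : x ∈ arrangementCompl n) (hy : y ∈ connectedComponentIn (arrangementCompl n) x)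
    {a b : Fin (2 * n)} (hab : a < b) (ha : Odd ((a : ℕ) + 1)) (hb : Even ((b : ℕ) + 1)) :
    y a.castSucc < y b.castSucc ↔ x a.castSucc < x b.castSucc := by
  have key : ∀ u ∈ connectedComponentIn (arrangementCompl n) x,
      ∀ v ∈ connectedComponentIn (arrangementCompl n) x,
      u a.castSucc < u b.castSucc → v a.castSucc < v b.castSucc := by
    intro u hu v hv huv
    by_contra hvv
    have hpc := (isPreconnected_connectedComponentIn (F := arrangementCompl n) (x := x)).image
      (fun z => z b.castSucc - z a.castSucc) (by fun_prop)
    obtain ⟨w, hw, hw0⟩ := hpc.Icc_subset (Set.mem_image_of_mem _ hv) (Set.mem_image_of_mem _ hu)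
      (show (0 : ℝ) ∈ _ from ⟨by linarith [not_lt.mp hvv], by linarith⟩)
    have hw1 := mem_arrangementCompl.mp (connectedComponentIn_subset _ _ hw) a b hab ha hb
    exact hw1 (by simp only at hw0; linarith)
  exact ⟨key y hy x (mem_connectedComponentIn hx), key x (mem_connectedComponentIn hx) y hy⟩

theorem mem_connectedComponentIn_of_sorts {n : ℕ} {x y : Fin (2 * n + 1) → ℝ}
    {π : Equiv.Perm (Fin (2 * n))} (hx : x ∈ arrangementCompl n) (hy : y ∈ arrangementCompl n)
    (hxπ : Sorts π x) (hyπ : Sorts π y) : y ∈ connectedComponentIn (arrangementCompl n) x := by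
  have hseg : segment ℝ x y ⊆ arrangementCompl n := by
    rintro z ⟨s, t, hs, ht, hst, rfl⟩
    rw [mem_arrangementCompl] at hx hy ⊢
    intro a b hab ha hb he
    have h1 := hx a b hab ha hb
    have h2 := hy a b hab ha hb
    have h3 := (hxπ a b hab ha hb).symm.trans (hyπ a b hab ha hb)
    simp only [Pi.add_apply, Pi.smul_apply, smul_eq_mul] at he
    rcases lt_or_gt_of_ne h1 with h | h
    · have h' := h3.mp h
      -- Strictness comes from the `x` term when its weight is positive; otherwise the point is `y`.
      rcases hs.eq_or_lt with rfl | hs'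
      · have : t = 1 := by linarith
        subst this
        linarith
      · nlinarith [mul_pos hs' (sub_pos.mpr h), mul_nonneg ht (sub_pos.mpr h').le]
    · have h' : y b.castSucc < y a.castSucc :=
        lt_of_le_of_ne (not_lt.mp fun h4 => lt_asymm h (h3.mpr h4)) h2.symm
      rcases hs.eq_or_lt with rfl | hs'
      · have : t = 1 := by linarith
        subst this
        linarith
      · nlinarith [mul_pos hs' (sub_pos.mpr h), mul_nonneg ht (sub_pos.mpr h').le]
  exact (convex_segment x y).isPreconnected.subset_connectedComponentIn
    (left_mem_segment ℝ x y) hseg (right_mem_segment ℝ x y)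

theorem compatible_iff_sorts {n : ℕ} {x : Fin (2 * n + 1) → ℝ} (hx : x ∈ arrangementCompl n)
    (π : Equiv.Perm (Fin (2 * n))) :
    Compatible π (connectedComponentIn (arrangementCompl n) x) ↔ Sorts π x := by
  constructor
  · intro h a b hab ha hb
    exact h a b hab ha hb x (mem_connectedComponentIn hx)
  · intro h a b hab ha hb y hy
    rw [h a b hab ha hb, lt_iff_of_mem_connectedComponentIn hx hy hab ha hb]

theorem Sorts.sorts_iff {n : ℕ} {x : Fin (2 * n + 1) → ℝ} {π ρ : Equiv.Perm (Fin (2 * n))}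
    (h : Sorts π x) : Sorts ρ x ↔ SameOrder Linked π ρ := by
  have hflip : ∀ (σ : Equiv.Perm (Fin (2 * n))) (a b : Fin (2 * n)), a ≠ b →
      (σ.symm a < σ.symm b ↔ ¬ σ.symm b < σ.symm a) := by
    intro σ a b hab
    rw [not_lt, le_iff_lt_or_eq, or_iff_left (σ.symm.injective.ne hab)]
  constructor
  · intro h' a b hab
    have key : ∀ c d : Fin (2 * n), (c : ℕ) % 2 = 0 → (d : ℕ) % 2 = 1 → (c : ℕ) < d →
        (π.symm c < π.symm d ↔ ρ.symm c < ρ.symm d) := by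
      intro c d hc hd hcd
      have ho : Odd ((c : ℕ) + 1) := by rw [Nat.odd_iff]; omega
      have he : Even ((d : ℕ) + 1) := by rw [Nat.even_iff]; omega
      rw [h c d hcd ho he, h' c d hcd ho he]
    rcases hab with ⟨h1, h2, h3⟩ | ⟨h1, h2, h3⟩
    · exact key a b h1 h2 h3
    · have hne : a ≠ b := by rintro rfl; exact lt_irrefl _ h3
      rw [hflip π a b hne, hflip ρ a b hne, key b a h1 h2 h3]
  · intro h' a b hab ha hb
    rw [← h a b hab ha hb]
    refine (h' a b (Or.inl ⟨?_, ?_, hab⟩)).symm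
    · rw [Nat.odd_iff] at ha; omega
    · rw [Nat.even_iff] at hb; omega

/-- If every order class of permutations has exactly one member in `G`, then the regions are
labeled by `G`. -/
theorem exists_isLabeling {n : ℕ} (G : Set (Equiv.Perm (Fin (2 * n))))
    (hex : ∀ σ : Equiv.Perm (Fin (2 * n)), ∃ τ ∈ G, SameOrder Linked σ τ)
    (huniq : ∀ σ ∈ G, ∀ τ ∈ G, SameOrder Linked σ τ → σ = τ) :
    ∃ Λ : regions n → G, IsLabeling G Λ := by
  have hreg : ∀ R : regions n, ∃ π : G, ∀ ρ : G,
      Compatible (ρ : Equiv.Perm (Fin (2 * n))) (R : Set _) ↔ ρ = π := by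
    rintro ⟨R, x, hx, rfl⟩
    obtain ⟨σ, hσ⟩ := exists_sorts hx
    obtain ⟨τ, hτG, hτ⟩ := hex σ
    refine ⟨⟨τ, hτG⟩, fun ρ => ?_⟩
    rw [compatible_iff_sorts hx, hσ.sorts_iff]
    constructor
    · intro h
      exact Subtype.ext (huniq _ ρ.2 _ hτG (h.symm.trans hτ))
    · rintro rfl
      exact hτ
  choose Λ hΛ using hreg
  refine ⟨Λ, ⟨?_, ?_⟩, hΛ⟩
  · rintro ⟨R, x, hx, rfl⟩ ⟨R', y, hy, rfl⟩ h
    have h1 := (hΛ ⟨_, x, hx, rfl⟩ _).mpr rfl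
    have h2 := (hΛ ⟨_, y, hy, rfl⟩ _).mpr rfl
    rw [← h] at h2
    have hmem := mem_connectedComponentIn_of_sorts hx hy
      ((compatible_iff_sorts hx _).mp h1) ((compatible_iff_sorts hy _).mp h2)
    exact Subtype.ext (connectedComponentIn_eq hmem)
  · intro π
    obtain ⟨x, hx, hπ⟩ := exists_point_sorts (π : Equiv.Perm (Fin (2 * n)))
    exact ⟨⟨_, x, hx, rfl⟩, ((hΛ ⟨_, x, hx, rfl⟩ π).mp ((compatible_iff_sorts hx _).mpr hπ)).symm⟩

/-! ### Lexicographic normal forms of order classes. -/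

theorem exists_first_difference {m : ℕ} {σ τ : Equiv.Perm (Fin m)} (h : σ ≠ τ) :
    ∃ p, (∀ k < p, σ k = τ k) ∧ σ p ≠ τ p := by
  have hne : ∃ p, σ p ≠ τ p := by
    by_contra hcon
    push Not at hcon
    exact h (Equiv.ext hcon)
  obtain ⟨p, hp, hmin⟩ := WellFounded.has_min (wellFounded_lt (α := Fin m)) {p | σ p ≠ τ p} hne
  exact ⟨p, fun k hk => by_contra fun hk' => hmin k hk' hk, hp⟩

/-- A letter that is not among the first letters of one permutation is not among those of
another permutation with the same first letters. -/
theorem le_symm_of_agree {m : ℕ} {σ τ : Equiv.Perm (Fin m)} {p : Fin m}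
    (h : ∀ k < p, σ k = τ k) {z : Fin m} (hz : p ≤ τ.symm z) : p ≤ σ.symm z := by
  by_contra hlt
  have h1 := h _ (not_le.mp hlt)
  rw [Equiv.apply_symm_apply] at h1
  have h2 : τ.symm z = σ.symm z := by rw [Equiv.symm_apply_eq, ← h1]
  rw [h2] at hz
  exact hlt hz

theorem lt_symm_of_agree {m : ℕ} {σ τ : Equiv.Perm (Fin m)} {p : Fin m}
    (h : ∀ k < p, σ k = τ k) {z : Fin m} (hz : p ≤ τ.symm z) (hne : z ≠ σ p) :
    p < σ.symm z := by
  refine lt_of_le_of_ne (le_symm_of_agree h hz) fun he => hne ?_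
  rw [he, Equiv.apply_symm_apply]

/-- No letter can be moved in front of a letter of larger rank by commutations of unrelated
letters. -/
def IsLexNormal {m : ℕ} (D : Fin m → Fin m → Prop) (r : Fin m → ℤ) (σ : Equiv.Perm (Fin m)) :
    Prop :=
  ∀ p q, p < q → r (σ q) < r (σ p) → ∃ k, p ≤ k ∧ k < q ∧ D (σ k) (σ q)

/-- At the first difference, the letter of smaller rank comes later in the other word, so normality
there puts a linked letter before it, past the common prefix. In the first word that linked letter
would have to lie inside the prefix. -/
theorem IsLexNormal.eq_of_sameOrder {m : ℕ} {D : Fin m → Fin m → Prop} {r : Fin m → ℤ}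
    (hr : Function.Injective r) {σ τ : Equiv.Perm (Fin m)}
    (hσ : IsLexNormal D r σ) (hτ : IsLexNormal D r τ) (h : SameOrder D σ τ) : σ = τ := by
  by_contra hne
  obtain ⟨p, hp, hpne⟩ := exists_first_difference hne
  have key : ∀ α β : Equiv.Perm (Fin m), IsLexNormal D r β → SameOrder D α β →
      (∀ k < p, α k = β k) → r (α p) < r (β p) → False := by
    intro α β hβ hαβ hag hlt
    have hag' : ∀ k < p, β k = α k := fun k hk => (hag k hk).symm
    have hq : p < β.symm (α p) := by
      refine lt_symm_of_agree hag' (by simp) ?_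
      intro he
      rw [he] at hlt
      exact lt_irrefl _ hlt
    obtain ⟨k, hpk, hkq, hk⟩ := hβ p _ hq (by simpa using hlt)
    rw [Equiv.apply_symm_apply] at hk
    have h1 : α.symm (β k) < α.symm (α p) := (hαβ _ _ hk).mpr (by simpa using hkq)
    have h2 : p ≤ α.symm (β k) := le_symm_of_agree hag (by simpa using hpk)
    rw [Equiv.symm_apply_apply] at h1
    exact absurd h1 (not_lt.mpr h2)
  rcases lt_or_gt_of_ne (hr.ne hpne) with hlt | hlt
  · exact key σ τ hτ h hp hlt
  · exact key τ σ hσ h.symm (fun k hk => (hp k hk).symm) hlt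

/-- The permutation obtained by moving the letter at the position `q` to the position `p`. -/
theorem exists_moveLeft {m : ℕ} (σ : Equiv.Perm (Fin m)) {p q : Fin m} (hpq : p < q) :
    ∃ τ : Equiv.Perm (Fin m), (∀ k < p, τ k = σ k) ∧ τ p = σ q ∧
      ∀ a b, a ≠ σ q → b ≠ σ q → (τ.symm a < τ.symm b ↔ σ.symm a < σ.symm b) := by
  have : NeZero m := ⟨by have := q.isLt; omega⟩
  have hval : ∀ k, k ≠ q →
      ((Fin.cycleIcc p q k : Fin m) : ℕ) = if p ≤ k ∧ k < q then (k : ℕ) + 1 else k := by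
    intro k hk
    split_ifs with h
    · rw [Fin.cycleIcc_of_ge_of_lt h.1 h.2]
      refine Fin.val_add_one_of_lt' ?_
      have := q.isLt
      have h2 : (k : ℕ) < q := h.2
      omega
    · rcases lt_or_ge k p with h' | h'
      · rw [Fin.cycleIcc_of_lt h']
      · have h'' : q < k := lt_of_le_of_ne (not_lt.mp fun h3 => h ⟨h', h3⟩) hk.symm
        rw [Fin.cycleIcc_of_gt h'']
  -- The cycle sends `q` to `p` and shifts `p, …, q - 1` up by one.
  refine ⟨(Fin.cycleIcc p q).symm.trans σ, fun k hk => ?_, ?_, fun a b ha hb => ?_⟩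
  · rw [Equiv.trans_apply, (Equiv.symm_apply_eq _).mpr (Fin.cycleIcc_of_lt hk).symm]
  · rw [Equiv.trans_apply, (Equiv.symm_apply_eq _).mpr (Fin.cycleIcc_of_last hpq.le).symm]
  · have ha' : σ.symm a ≠ q := fun h => ha ((Equiv.symm_apply_eq _).mp h)
    have hb' : σ.symm b ≠ q := fun h => hb ((Equiv.symm_apply_eq _).mp h)
    have h1 := hval _ ha'
    have h2 := hval _ hb'
    rw [Equiv.symm_trans_apply, Equiv.symm_trans_apply, Equiv.symm_symm, Fin.lt_def, Fin.lt_def,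
      h1, h2]
    simp only [Fin.lt_def, Fin.le_def, ne_eq, Fin.ext_iff] at ha' hb' hpq ⊢
    split_ifs <;> omega

/-- The lexicographically least rank word of the class works: at a violation, moving the later
letter forward passes only unlinked letters, so it stays in the class and gives a smaller word. -/
theorem exists_isLexNormal {m : ℕ} {D : Fin m → Fin m → Prop} (r : Fin m → ℤ)
    (hDs : ∀ a b, D a b → D b a) (hD : ∀ a b, D a b → a ≠ b) (σ : Equiv.Perm (Fin m)) :
    ∃ τ, IsLexNormal D r τ ∧ SameOrder D σ τ := by
  obtain ⟨τ, hτ, hmin⟩ := Set.exists_min_image {τ | SameOrder D σ τ}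
    (fun τ => toLex (fun i => r (τ i))) (Set.toFinite _) ⟨σ, fun _ _ _ => Iff.rfl⟩
  refine ⟨τ, fun p q hpq hlt => ?_, hτ⟩
  by_contra hcon
  push Not at hcon
  obtain ⟨ρ, hρ1, hρ2, hρ3⟩ := exists_moveLeft τ hpq
  refine absurd (hmin ρ (SameOrder.trans hτ ?_)) (not_le.mpr ?_)
  · have hq : ∀ b, D b (τ q) → (τ.symm b < q ↔ ρ.symm b < p) := by
      intro b hb
      constructor
      · intro hbq
        have hbp : τ.symm b < p := by
          by_contra hle
          exact hcon _ (not_lt.mp hle) hbq (by simpa using hb)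
        have h1 := hρ1 _ hbp
        rw [Equiv.apply_symm_apply] at h1
        rwa [(Equiv.symm_apply_eq ρ).mpr h1.symm]
      · intro hbp
        by_contra hle
        exact absurd (le_symm_of_agree hρ1 (hpq.le.trans (not_lt.mp hle))) (not_le.mpr hbp)
    have hqρ : ρ.symm (τ q) = p := (Equiv.symm_apply_eq ρ).mpr hρ2.symm
    intro a b hab
    by_cases ha : a = τ q
    · subst ha
      have h1 := hq b (hDs _ _ hab)
      have h2 : b ≠ τ q := (hD _ _ hab).symm
      have h3 : τ.symm b ≠ q := fun h => h2 ((Equiv.symm_apply_eq _).mp h)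
      have h4 : ρ.symm b ≠ p := fun h => h2 (((Equiv.symm_apply_eq _).mp h).trans hρ2)
      rw [hqρ, Equiv.symm_apply_apply, ← not_iff_not, not_lt, not_lt, h3.le_iff_lt,
        h4.le_iff_lt, h1]
    · by_cases hb : b = τ q
      · subst hb
        rw [hqρ, Equiv.symm_apply_apply, hq a hab]
      · exact (hρ3 a b ha hb).symm
  · exact ⟨p, fun j hj => by simp [hρ1 j hj], by simpa [hρ2] using hlt⟩

/-! ### Types II and III as lexicographic normal forms. -/

/-- A `Fin` value is one less than its letter, so parities are reversed. -/
theorem odd_letter {m : ℕ} {σ : Equiv.Perm (Fin m)} {i : Fin m} :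
    Odd (letter σ i) ↔ (σ i : ℕ) % 2 = 0 := by
  rw [letter, Nat.odd_iff]
  omega

theorem even_letter {m : ℕ} {σ : Equiv.Perm (Fin m)} {i : Fin m} :
    Even (letter σ i) ↔ (σ i : ℕ) % 2 = 1 := by
  rw [letter, Nat.even_iff]
  omega

theorem letter_lt_letter {m : ℕ} {σ : Equiv.Perm (Fin m)} {i j : Fin m} :
    letter σ i < letter σ j ↔ (σ i : ℕ) < σ j := by
  rw [letter, letter]
  omega

theorem exists_last_between {m : ℕ} {P : Fin m → Prop} {p q : Fin m} (hpq : p < q) (hp : P p) :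
    ∃ k, p ≤ k ∧ k < q ∧ P k ∧ ∀ l, k < l → l < q → ¬ P l := by
  obtain ⟨k, ⟨h1, h2, h3⟩, hmax⟩ := WellFounded.has_min (wellFounded_gt (α := Fin m))
    {k | p ≤ k ∧ k < q ∧ P k} ⟨p, le_rfl, hpq, hp⟩
  exact ⟨k, h1, h2, h3, fun l hkl hlq hl => hmax l ⟨h1.trans hkl.le, hlq, hl⟩ hkl⟩

theorem exists_first_between {m : ℕ} {P : Fin m → Prop} {p q : Fin m} (hpq : p < q) (hq : P q) :
    ∃ k, p < k ∧ k ≤ q ∧ P k ∧ ∀ l, p < l → l < k → ¬ P l := by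
  obtain ⟨k, ⟨h1, h2, h3⟩, hmin⟩ := WellFounded.has_min (wellFounded_lt (α := Fin m))
    {k | p < k ∧ k ≤ q ∧ P k} ⟨q, hpq, le_rfl, hq⟩
  exact ⟨k, h1, h2, h3, fun l hpl hlk hl => hmin l ⟨hpl, hlk.le.trans h2, hl⟩ hlk⟩

/-- A word that is not in normal form has a shortest factor showing it. -/
theorem exists_factor_of_not_isLexNormal {m : ℕ} {D : Fin m → Fin m → Prop} {r : Fin m → ℤ}
    {σ : Equiv.Perm (Fin m)} (h : ¬ IsLexNormal D r σ) :
    ∃ p q, p < q ∧ r (σ q) < r (σ p) ∧ (∀ k, p < k → k ≤ q → ¬ r (σ q) < r (σ k)) ∧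
      ∀ k, p ≤ k → k < q → ¬ D (σ k) (σ q) := by
  unfold IsLexNormal at h
  push Not at h
  obtain ⟨p, q, hpq, hr, hD⟩ := h
  -- Taking the last position of larger rank bounds every later rank up to `q` by that of `σ q`.
  obtain ⟨k, h1, h2, h3, h4⟩ := exists_last_between (P := fun k => r (σ q) < r (σ k)) hpq hr
  refine ⟨k, q, h2, h3, fun l hkl hlq => ?_, fun l hkl hlq => hD l (h1.trans hkl) hlq⟩
  rcases hlq.eq_or_lt with rfl | hlq
  · exact lt_irrefl _
  · exact h4 l hkl hlq

/-- The rank for which odd letters come first, in decreasing order, and then even letters, in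
increasing order. -/
def rankII {m : ℕ} (a : Fin m) : ℤ := if (a : ℕ) % 2 = 0 then -((a : ℕ) : ℤ) else (a : ℕ)

/-- The rank for which odd letters come first, in increasing order, and then even letters, in
decreasing order. -/
def rankIII {m : ℕ} (a : Fin m) : ℤ :=
  if (a : ℕ) % 2 = 0 then ((a : ℕ) : ℤ) - m else m - ((a : ℕ) : ℤ)

theorem rankII_injective {m : ℕ} : Function.Injective (rankII (m := m)) := by
  intro a b h
  apply Fin.ext
  unfold rankII at h
  split_ifs at h <;> omega

theorem rankIII_injective {m : ℕ} : Function.Injective (rankIII (m := m)) := by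
  intro a b h
  apply Fin.ext
  unfold rankIII at h
  have := a.isLt
  have := b.isLt
  split_ifs at h <;> omega

theorem rankII_lt_rankII {m : ℕ} {a b : Fin m} : rankII a < rankII b ↔
    ((a : ℕ) % 2 = 0 ∧ (b : ℕ) % 2 = 1) ∨ ((a : ℕ) % 2 = 0 ∧ (b : ℕ) % 2 = 0 ∧ (b : ℕ) < a) ∨
      ((a : ℕ) % 2 = 1 ∧ (b : ℕ) % 2 = 1 ∧ (a : ℕ) < b) := by
  unfold rankII
  split_ifs <;> omega

theorem rankIII_lt_rankIII {m : ℕ} {a b : Fin m} : rankIII a < rankIII b ↔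
    ((a : ℕ) % 2 = 0 ∧ (b : ℕ) % 2 = 1) ∨ ((a : ℕ) % 2 = 0 ∧ (b : ℕ) % 2 = 0 ∧ (a : ℕ) < b) ∨
      ((a : ℕ) % 2 = 1 ∧ (b : ℕ) % 2 = 1 ∧ (b : ℕ) < a) := by
  have := a.isLt
  have := b.isLt
  unfold rankIII
  split_ifs <;> omega

/-- Each forbidden pattern is a rank descent whose last letter is linked to nothing in the factor.
Conversely, in a shortest bad factor ending in an odd letter, all letters after the first are odd,
giving `Oo` or `eO_d`; if it ends in an even letter, its first two letters form `eE` or `eO`. -/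
theorem mem_GIII_iff {n : ℕ} {σ : Equiv.Perm (Fin (2 * n))} :
    σ ∈ GIII n ↔ IsLexNormal Linked rankIII σ := by
  constructor
  · rintro ⟨hOo, heE, heO⟩
    by_contra hnot
    obtain ⟨p, q, hpq, hlt, hle, hD⟩ := exists_factor_of_not_isLexNormal hnot
    have hpq' : (p : ℕ) < q := hpq
    obtain ⟨s, hs⟩ : ∃ s : Fin (2 * n), (s : ℕ) = p + 1 := ⟨⟨p + 1, by omega⟩, rfl⟩
    have hps : p < s := by rw [Fin.lt_def]; omega
    have hsq : s ≤ q := by rw [Fin.le_def]; omega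
    have hrs := hle s hps hsq
    rw [rankIII_lt_rankIII] at hrs hlt
    have hDp := hD p le_rfl hpq
    have hOo' := hOo p s
    have heE' := heE p s
    have heO' := heO 0 p s
    simp only [DescentAt, AscentAt, eOAt, odd_letter, even_letter, letter_lt_letter, gt_iff_lt]
      at hOo' heE' heO'
    unfold Linked at hDp
    rcases Nat.mod_two_eq_zero_or_one (σ q) with hq | hq
    · rcases Nat.mod_two_eq_zero_or_one (σ p) with hp | hp
      · refine hOo' ⟨hs, hp, ?_, ?_⟩
        · omega
        · omega
      · refine heO ((q : ℕ) - p - 1) p q ⟨by omega, ⟨even_letter.mpr hp, fun l hpl hlq => ?_⟩, ?_⟩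
        · rw [odd_letter]
          have h1 := hle l hpl hlq
          rw [rankIII_lt_rankIII] at h1
          omega
        · rw [letter_lt_letter]
          have hne : (σ p : ℕ) ≠ σ q := by omega
          omega
    · have hp : (σ p : ℕ) % 2 = 1 := by
        omega
      have hlt' : (σ p : ℕ) < σ q := by
        omega
      rcases Nat.mod_two_eq_zero_or_one (σ s) with h | h
      · refine heO' ⟨hs, ⟨hp, fun l hpl hls => ?_⟩, ?_⟩
        · have : l = s := by
            rw [Fin.lt_def] at hpl
            rw [Fin.le_def] at hls
            apply Fin.ext
            omega
          rw [this]
          exact h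
        · have hsq' : s < q := lt_of_le_of_ne hsq (by rintro rfl; omega)
          have hDs := hD s hps.le hsq'
          unfold Linked at hDs
          omega
      · refine heE' ⟨hs, hp, h, ?_⟩
        omega
  · intro h
    have adj : ∀ i j : Fin (2 * n), (j : ℕ) = i + 1 → ∀ k, i ≤ k → k < j → k = i := by
      intro i j hij k h1 h2
      rw [Fin.le_def] at h1
      rw [Fin.lt_def] at h2
      apply Fin.ext
      omega
    refine ⟨?_, ?_, ?_⟩
    · rintro i j ⟨hij, hi, hj, hlt⟩
      rw [odd_letter] at hi hj
      rw [gt_iff_lt, letter_lt_letter] at hlt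
      obtain ⟨k, h1, h2, h3⟩ := h i j (by rw [Fin.lt_def]; omega) (by
        rw [rankIII_lt_rankIII]; omega)
      rw [adj i j hij k h1 h2] at h3
      unfold Linked at h3
      omega
    · rintro i j ⟨hij, hi, hj, hlt⟩
      rw [even_letter] at hi hj
      rw [letter_lt_letter] at hlt
      obtain ⟨k, h1, h2, h3⟩ := h i j (by rw [Fin.lt_def]; omega) (by
        rw [rankIII_lt_rankIII]; omega)
      rw [adj i j hij k h1 h2] at h3
      unfold Linked at h3
      omega
    · rintro d i j ⟨hij, ⟨hi, hodd⟩, hlt⟩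
      have hij' : i < j := by rw [Fin.lt_def]; omega
      have hj := hodd j hij' le_rfl
      rw [odd_letter] at hj
      rw [even_letter] at hi
      rw [letter_lt_letter] at hlt
      obtain ⟨k, h1, h2, h3⟩ := h i j hij' (by
        rw [rankIII_lt_rankIII]; omega)
      unfold Linked at h3
      rcases h1.eq_or_lt with rfl | h1
      · omega
      · have := odd_letter.mp (hodd k h1 h2.le)
        omega

/-- `Ee`, `eO` and `oO` are rank descents of unlinked neighbours. An `Oe` is no rank descent, but if
an even letter precedes it, its even letter could be commuted in front of the last such letter. -/
theorem mem_GII_iff {n : ℕ} {σ : Equiv.Perm (Fin (2 * n))} :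
    σ ∈ GII n ↔ IsLexNormal Linked rankII σ := by
  constructor
  · rintro ⟨hEe, heO, hoO, hOe⟩
    by_contra hnot
    obtain ⟨p, q, hpq, hlt, hle, hD⟩ := exists_factor_of_not_isLexNormal hnot
    have hpq' : (p : ℕ) < q := hpq
    obtain ⟨s, hs⟩ : ∃ s : Fin (2 * n), (s : ℕ) = p + 1 := ⟨⟨p + 1, by omega⟩, rfl⟩
    have hps : p < s := by rw [Fin.lt_def]; omega
    have hsq : s ≤ q := by rw [Fin.le_def]; omega
    have hrs := hle s hps hsq
    rw [rankII_lt_rankII] at hrs hlt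
    have hDp := hD p le_rfl hpq
    have hEe' := hEe p s
    have heO' := heO p s
    have hoO' := hoO p s
    simp only [DescentAt, AscentAt, odd_letter, even_letter, letter_lt_letter, gt_iff_lt]
      at hEe' heO' hoO'
    unfold Linked at hDp
    rcases Nat.mod_two_eq_zero_or_one (σ q) with hq | hq
    · have hs' : (σ s : ℕ) % 2 = 0 := by
        omega
      rcases Nat.mod_two_eq_zero_or_one (σ p) with hp | hp
      · refine hoO' ⟨hs, hp, hs', ?_⟩
        omega
      · refine heO' ⟨hs, hp, hs', ?_⟩
        omega
    · have hp : (σ p : ℕ) % 2 = 1 := by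
        omega
      have hlt' : (σ q : ℕ) < σ p := by
        omega
      rcases Nat.mod_two_eq_zero_or_one (σ s) with h | h
      · have hsq' : s < q := lt_of_le_of_ne hsq (by rintro rfl; omega)
        -- The last odd letter before `q` is unlinked to `σ q`, hence larger, so with its even
        -- successor it forms an `Oe`. The even letter at `p` prevents it from being initial.
        obtain ⟨k, h1, h2, h3, h4⟩ :=
          exists_last_between (P := fun k => (σ k : ℕ) % 2 = 0) hsq' h
        have h2' : (k : ℕ) < q := h2
        obtain ⟨t, ht⟩ : ∃ t : Fin (2 * n), (t : ℕ) = k + 1 := ⟨⟨k + 1, by omega⟩, rfl⟩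
        have hkt : k < t := by rw [Fin.lt_def]; omega
        have htq : t ≤ q := by rw [Fin.le_def]; omega
        have ht' : (σ t : ℕ) % 2 = 1 := by
          rcases htq.eq_or_lt with rfl | htq
          · exact hq
          · have := h4 t hkt htq
            omega
        have hDk := hD k (hps.le.trans h1) h2
        unfold Linked at hDk
        have hrt := hle t ((hps.trans_le h1).trans hkt) htq
        rw [rankII_lt_rankII] at hrt
        have hdesc : DescentAt Odd Even σ k t := by
          refine ⟨ht, odd_letter.mpr h3, even_letter.mpr ht', ?_⟩
          rw [gt_iff_lt, letter_lt_letter]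
          omega
        have := odd_letter.mp ((hOe k t hdesc).1 p (hps.le.trans h1))
        omega
      · refine hEe' ⟨hs, hp, h, ?_⟩
        omega
  · intro h
    have adj : ∀ i j : Fin (2 * n), (j : ℕ) = i + 1 → rankII (σ j) < rankII (σ i) →
        Linked (σ i) (σ j) := by
      intro i j hij hr
      obtain ⟨k, h1, h2, h3⟩ := h i j (by rw [Fin.lt_def]; omega) hr
      have hk : k = i := by
        rw [Fin.le_def] at h1
        rw [Fin.lt_def] at h2
        apply Fin.ext
        omega
      rwa [hk] at h3
    have hEe : ∀ i j, ¬ DescentAt Even Even σ i j := by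
      rintro i j ⟨hij, hi, hj, hlt⟩
      rw [even_letter] at hi hj
      rw [gt_iff_lt, letter_lt_letter] at hlt
      have h3 := adj i j hij (by rw [rankII_lt_rankII]; omega)
      unfold Linked at h3
      omega
    have heO : ∀ i j, ¬ AscentAt Even Odd σ i j := by
      rintro i j ⟨hij, hi, hj, hlt⟩
      rw [even_letter] at hi
      rw [odd_letter] at hj
      rw [letter_lt_letter] at hlt
      have h3 := adj i j hij (by rw [rankII_lt_rankII]; omega)
      unfold Linked at h3
      omega
    have hoO : ∀ i j, ¬ AscentAt Odd Odd σ i j := by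
      rintro i j ⟨hij, hi, hj, hlt⟩
      rw [odd_letter] at hi hj
      rw [letter_lt_letter] at hlt
      have h3 := adj i j hij (by rw [rankII_lt_rankII]; omega)
      unfold Linked at h3
      omega
    refine ⟨hEe, heO, hoO, ?_⟩
    rintro i j ⟨hij, hi, hj, hlt⟩
    rw [odd_letter] at hi
    rw [even_letter] at hj
    rw [gt_iff_lt, letter_lt_letter] at hlt
    have hne : ∀ k l : Fin (2 * n), (k : ℕ) ≠ l → (σ k : ℕ) ≠ σ l := by
      intro k l hkl he
      exact hkl (congrArg Fin.val (σ.injective (Fin.ext he)))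
    -- An odd factor is decreasing.
    have hdec : ∀ d : ℕ, ∀ k l : Fin (2 * n), (l : ℕ) = k + d →
        (∀ t, k ≤ t → t ≤ l → (σ t : ℕ) % 2 = 0) → (σ l : ℕ) ≤ σ k := by
      intro d
      induction d with
      | zero =>
        intro k l hkl _
        have : k = l := Fin.ext (by omega)
        rw [this]
      | succ d ih =>
        intro k l hkl hodd
        obtain ⟨t, ht⟩ : ∃ t : Fin (2 * n), (t : ℕ) = k + d :=
          ⟨⟨k + d, by have := l.isLt; omega⟩, rfl⟩
        have htl : t ≤ l := by rw [Fin.le_def]; omega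
        have hkt : k ≤ t := by rw [Fin.le_def]; omega
        have h1 := ih k t ht fun u hu hu' => hodd u hu (hu'.trans htl)
        have h2 := hoO t l
        simp only [AscentAt, odd_letter, letter_lt_letter] at h2
        have h3 := hodd t hkt htl
        have h4 := hodd l (hkt.trans htl) le_rfl
        have h5 := hne t l (by omega)
        by_contra hcon
        exact h2 ⟨by omega, h3, h4, by omega⟩
    have hodd : ∀ l, l ≤ i → (σ l : ℕ) % 2 = 0 := by
      intro l hl
      by_contra hl'
      have hli : l < i := lt_of_le_of_ne hl (by rintro rfl; exact hl' hi)
      obtain ⟨k, h1, h2, h3, h4⟩ :=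
        exists_last_between (P := fun k => ¬ (σ k : ℕ) % 2 = 0) hli hl'
      have h2' : (k : ℕ) < i := h2
      have h4' : ∀ t, k < t → t ≤ i → (σ t : ℕ) % 2 = 0 := by
        intro t hkt hti
        rcases hti.eq_or_lt with rfl | hti
        · exact hi
        · exact not_not.mp (h4 t hkt hti)
      have hge : ∀ t, k < t → t ≤ i → (σ i : ℕ) ≤ σ t := by
        intro t hkt hti
        refine hdec ((i : ℕ) - t) t i (by rw [Fin.le_def] at hti; omega) ?_
        intro u hu hu'
        exact h4' u (hkt.trans_le hu) hu'
      obtain ⟨t, ht⟩ : ∃ t : Fin (2 * n), (t : ℕ) = k + 1 := ⟨⟨k + 1, by omega⟩, rfl⟩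
      have hkt : k < t := by rw [Fin.lt_def]; omega
      have hti : t ≤ i := by rw [Fin.le_def]; omega
      have h5 := heO k t
      simp only [AscentAt, even_letter, odd_letter, letter_lt_letter] at h5
      have h6 := h4' t hkt hti
      have h7 := hge t hkt hti
      have h8 : ¬ (σ k : ℕ) < σ t := fun h8 => h5 ⟨ht, by omega, h6, h8⟩
      -- From the last even letter, at `k`, up to `i` all letters exceed `σ j`, so none is linked to
      -- it, although `σ k` has larger rank.
      obtain ⟨u, hu1, hu2, hu3⟩ := h k j (by rw [Fin.lt_def]; omega) (by
        rw [rankII_lt_rankII]; omega)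
      unfold Linked at hu3
      rcases hu1.eq_or_lt with rfl | hu1
      · omega
      · have hui : u ≤ i := by
          rw [Fin.lt_def] at hu2
          rw [Fin.le_def]
          omega
        have := hge u hu1 hui
        have := h4' u hu1 hui
        omega
    refine ⟨fun l hl => odd_letter.mpr (hodd l hl), fun l l' hll hlj => ?_⟩
    rw [gt_iff_lt, letter_lt_letter]
    rw [Fin.lt_def] at hll
    rw [Fin.le_def] at hlj
    have hdec' : ∀ a b : Fin (2 * n), (a : ℕ) ≤ b → (b : ℕ) ≤ i → (σ b : ℕ) ≤ σ a := by
      intro a b hab hbi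
      refine hdec ((b : ℕ) - a) a b (by omega) fun t _ htb => hodd t ?_
      rw [Fin.le_def] at htb ⊢
      omega
    rcases Nat.lt_or_ge (i : ℕ) l' with hil | hil
    · have : l' = j := Fin.ext (by omega)
      subst this
      exact hlt.trans_le (hdec' l i (by omega) le_rfl)
    · exact lt_of_le_of_ne (hdec' l l' hll.le hil) (hne _ _ (by omega))

/-! ### Type IV as block normal forms. -/

/-- Every descent between even letters is separated by an odd letter that is smaller than both,
every descent between odd letters is separated by an even letter that is larger than both, and
an even letter directly before an odd one is the larger of the two. -/
structure IsBlockNormal {m : ℕ} (σ : Equiv.Perm (Fin m)) : Prop where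
  even_even : ∀ i j, i < j → (σ i : ℕ) % 2 = 1 → (σ j : ℕ) % 2 = 1 → (σ j : ℕ) < σ i →
    ∃ l, i < l ∧ l < j ∧ (σ l : ℕ) % 2 = 0 ∧ (σ l : ℕ) < σ j
  odd_odd : ∀ i j, i < j → (σ i : ℕ) % 2 = 0 → (σ j : ℕ) % 2 = 0 → (σ j : ℕ) < σ i →
    ∃ l, i < l ∧ l < j ∧ (σ l : ℕ) % 2 = 1 ∧ (σ i : ℕ) < σ l
  even_odd : ∀ i j : Fin m, (j : ℕ) = i + 1 → (σ i : ℕ) % 2 = 1 → (σ j : ℕ) % 2 = 0 →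
    (σ j : ℕ) < σ i

/-- The patterns concern consecutive letters of one parity, the normal form all descents of that
parity. An unseparated descent contains a consecutive one with the same defect; avoiding `eO`
supplies the comparison of `min α` or `max α` with the remaining end. -/
theorem mem_GIV_iff {n : ℕ} {σ : Equiv.Perm (Fin (2 * n))} :
    σ ∈ GIV n ↔ IsBlockNormal σ := by
  constructor
  · rintro ⟨heO, hOo, hEe⟩
    have hC : ∀ i j : Fin (2 * n), (j : ℕ) = i + 1 → (σ i : ℕ) % 2 = 1 → (σ j : ℕ) % 2 = 0 →
        (σ j : ℕ) < σ i := by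
      intro i j hij hi hj
      by_contra hcon
      refine heO i j ⟨hij, even_letter.mpr hi, odd_letter.mpr hj, letter_lt_letter.mpr ?_⟩
      have : (σ i : ℕ) ≠ σ j := by
        intro h
        rw [h] at hi
        omega
      omega
    refine ⟨?_, ?_, hC⟩
    · intro i j hij hi hj hlt
      by_contra hcon
      push Not at hcon
      obtain ⟨k, h1, h2, ⟨h3, h3'⟩, h4⟩ := exists_last_between
        (P := fun k => (σ k : ℕ) % 2 = 1 ∧ (σ j : ℕ) < σ k) hij ⟨hi, hlt⟩
      obtain ⟨f, f1, f2, f3, f4⟩ := exists_first_between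
        (P := fun k => (σ k : ℕ) % 2 = 1) h2 hj
      have hfj : (σ f : ℕ) ≤ σ j := by
        rcases f2.eq_or_lt with rfl | f2
        · exact le_rfl
        · by_contra h
          exact h4 f f1 f2 ⟨f3, not_le.mp h⟩
      have f1' : (k : ℕ) < f := f1
      refine hEe ((f : ℕ) - k - 1) k f ⟨by omega, even_letter.mpr h3, even_letter.mpr f3,
        fun l hkl hlf => ?_, fun _ => ?_, fun hd => ⟨?_, fun l hkl hlf => ?_⟩⟩
      · rw [odd_letter]
        have := f4 l hkl hlf
        omega
      · rw [gt_iff_lt, letter_lt_letter]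
        omega
      · obtain ⟨s, hs⟩ : ∃ s : Fin (2 * n), (s : ℕ) = k + 1 := ⟨⟨k + 1, by omega⟩, rfl⟩
        have hks : k < s := by rw [Fin.lt_def]; omega
        have hsf : s < f := by rw [Fin.lt_def]; omega
        refine ⟨s, hks, hsf, ?_⟩
        rw [gt_iff_lt, letter_lt_letter]
        have := f4 s hks hsf
        exact hC k s hs h3 (by omega)
      · rw [gt_iff_lt, letter_lt_letter]
        have h5 := f4 l hkl hlf
        have h6 := hcon l (h1.trans_lt hkl) (hlf.trans_le f2) (by omega)
        have h7 : (σ l : ℕ) ≠ σ j := fun h => by rw [h] at h5; exact h5 hj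
        omega
    · intro i j hij hi hj hlt
      by_contra hcon
      push Not at hcon
      obtain ⟨k, h1, h2, ⟨h3, h3'⟩, h4⟩ := exists_first_between
        (P := fun k => (σ k : ℕ) % 2 = 0 ∧ (σ k : ℕ) < σ i) hij ⟨hj, hlt⟩
      obtain ⟨f, f1, f2, f3, f4⟩ := exists_last_between
        (P := fun k => (σ k : ℕ) % 2 = 0) h1 hi
      have hfi : (σ i : ℕ) ≤ σ f := by
        rcases f1.eq_or_lt with rfl | f1
        · exact le_rfl
        · by_contra h
          exact h4 f f1 f2 ⟨f3, not_le.mp h⟩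
      have f2' : (f : ℕ) < k := f2
      refine hOo ((k : ℕ) - f - 1) f k ⟨by omega, odd_letter.mpr f3, odd_letter.mpr h3,
        fun l hfl hlk => ?_, fun _ => ?_, fun hd => ⟨fun l hfl hlk => ?_, ?_⟩⟩
      · rw [even_letter]
        have := f4 l hfl hlk
        omega
      · rw [gt_iff_lt, letter_lt_letter]
        omega
      · rw [gt_iff_lt, letter_lt_letter]
        have h5 := f4 l hfl hlk
        have h6 := hcon l (f1.trans_lt hfl) (hlk.trans_le h2) (by omega)
        have h7 : (σ l : ℕ) ≠ σ i := fun h => by rw [h] at h5; exact h5 hi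
        omega
      · obtain ⟨s, hs⟩ : ∃ s : Fin (2 * n), (s : ℕ) = k - 1 := ⟨⟨k - 1, by omega⟩, rfl⟩
        have hfs : f < s := by rw [Fin.lt_def]; omega
        have hsk : s < k := by rw [Fin.lt_def]; omega
        refine ⟨s, hfs, hsk, ?_⟩
        rw [gt_iff_lt, letter_lt_letter]
        have := f4 s hfs hsk
        exact hC s k (by omega) (by omega) h3
  · intro h
    refine ⟨?_, ?_, ?_⟩
    · rintro i j ⟨hij, hi, hj, hlt⟩
      exact lt_asymm (letter_lt_letter.mp hlt)
        (h.even_odd i j hij (even_letter.mp hi) (odd_letter.mp hj))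
    · rintro d i j ⟨hij, hi, hj, hev, h0, hpos⟩
      have hlt : letter σ j < letter σ i := by
        rcases Nat.eq_zero_or_pos d with hd | hd
        · exact h0 hd
        · obtain ⟨h1, l, hl1, hl2, hl3⟩ := hpos hd
          exact lt_trans hl3 (h1 l hl1 hl2)
      obtain ⟨l, hl1, hl2, hl3, hl4⟩ := h.odd_odd i j (by rw [Fin.lt_def]; omega)
        (odd_letter.mp hi) (odd_letter.mp hj) (letter_lt_letter.mp hlt)
      rw [Fin.lt_def] at hl1 hl2
      exact lt_asymm (letter_lt_letter.mpr hl4) ((hpos (by omega)).1 l hl1 hl2)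
    · rintro d i j ⟨hij, hi, hj, hev, h0, hpos⟩
      have hlt : letter σ j < letter σ i := by
        rcases Nat.eq_zero_or_pos d with hd | hd
        · exact h0 hd
        · obtain ⟨⟨l, hl1, hl2, hl3⟩, h1⟩ := hpos hd
          exact lt_trans (h1 l hl1 hl2) hl3
      obtain ⟨l, hl1, hl2, hl3, hl4⟩ := h.even_even i j (by rw [Fin.lt_def]; omega)
        (even_letter.mp hi) (even_letter.mp hj) (letter_lt_letter.mp hlt)
      rw [Fin.lt_def] at hl1 hl2
      exact lt_asymm (letter_lt_letter.mpr hl4) ((hpos (by omega)).2 l hl1 hl2)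

/-! ### Uniqueness of block normal forms. -/

/-- Two block normal permutations of the same class do not differ first in two even letters. -/
theorem IsBlockNormal.not_even_even {m : ℕ} {σ τ : Equiv.Perm (Fin m)} (hτ : IsBlockNormal τ)
    (h : SameOrder Linked σ τ) {p : Fin m} (hp : ∀ k < p, σ k = τ k)
    (hσp : (σ p : ℕ) % 2 = 1) (hτp : (τ p : ℕ) % 2 = 1) : ¬ (σ p : ℕ) < τ p := by
  intro hlt
  have hq : p < τ.symm (σ p) := by
    refine lt_symm_of_agree (fun k hk => (hp k hk).symm) (by simp) fun he => ?_
    rw [he] at hlt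
    exact lt_irrefl _ hlt
  -- The separating letter is linked to `σ p`, so in `σ` it would precede position `p`, where the
  -- words agree.
  obtain ⟨l, h1, h2, h3, h4⟩ := hτ.even_even p _ hq hτp (by simpa using hσp) (by simpa using hlt)
  rw [Equiv.apply_symm_apply] at h4
  have h5 := (h (τ l) (σ p) (Or.inl ⟨h3, hσp, h4⟩)).mpr (by simpa using h2)
  have h6 : p ≤ σ.symm (τ l) := le_symm_of_agree hp (by simpa using h1.le)
  rw [Equiv.symm_apply_apply] at h5
  exact absurd h5 (not_lt.mpr h6)

/-- Two block normal permutations of the same class do not differ first in two odd letters. -/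
theorem IsBlockNormal.not_odd_odd {m : ℕ} {σ τ : Equiv.Perm (Fin m)} (hτ : IsBlockNormal τ)
    (h : SameOrder Linked σ τ) {p : Fin m} (hp : ∀ k < p, σ k = τ k)
    (hσp : (σ p : ℕ) % 2 = 0) (hτp : (τ p : ℕ) % 2 = 0) : ¬ (σ p : ℕ) < τ p := by
  intro hlt
  have hq : p < τ.symm (σ p) := by
    refine lt_symm_of_agree (fun k hk => (hp k hk).symm) (by simp) fun he => ?_
    rw [he] at hlt
    exact lt_irrefl _ hlt
  obtain ⟨l, h1, h2, h3, h4⟩ := hτ.odd_odd p _ hq hτp (by simpa using hσp) (by simpa using hlt)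
  have h5 := (h (τ l) (σ p) (Or.inr ⟨hσp, h3, hlt.trans h4⟩)).mpr (by simpa using h2)
  have h6 : p ≤ σ.symm (τ l) := le_symm_of_agree hp (by simpa using h1.le)
  rw [Equiv.symm_apply_apply] at h5
  exact absurd h5 (not_lt.mpr h6)

/-- Two block normal permutations of the same class do not differ first in letters of different
parities. -/
theorem IsBlockNormal.not_odd_even {m : ℕ} {σ τ : Equiv.Perm (Fin m)} (hσ : IsBlockNormal σ)
    (hτ : IsBlockNormal τ) (h : SameOrder Linked σ τ) {p : Fin m} (hp : ∀ k < p, σ k = τ k)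
    (hσp : (σ p : ℕ) % 2 = 0) : ¬ (τ p : ℕ) % 2 = 1 := by
  intro hτp
  have hp' : ∀ k < p, τ k = σ k := fun k hk => (hp k hk).symm
  have hq : p < τ.symm (σ p) := by
    refine lt_symm_of_agree hp' (by simp) fun he => ?_
    rw [he] at hσp
    omega
  obtain ⟨f, f1, f2, f3, f4⟩ := exists_first_between (P := fun k => (τ k : ℕ) % 2 = 0) hq
    (by simpa using hσp)
  have f1' : (p : ℕ) < f := f1
  obtain ⟨s, hs⟩ : ∃ s : Fin m, (s : ℕ) = f - 1 := ⟨⟨f - 1, by omega⟩, rfl⟩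
  have hsf : s < f := by rw [Fin.lt_def]; omega
  have hps : p ≤ s := by rw [Fin.le_def]; omega
  have hs1 : (τ s : ℕ) % 2 = 1 := by
    rcases hps.eq_or_lt with rfl | hps
    · exact hτp
    · have := f4 s hps hsf
      omega
  -- A letter after the position `p` in `τ` that precedes `σ p` there is not linked to `σ p`.
  have hun : ∀ l, p ≤ l → l < τ.symm (σ p) → ¬ Linked (τ l) (σ p) := by
    intro l hpl hl hlink
    have h5 := (h _ _ hlink).mpr (by simpa using hl)
    have h6 : p ≤ σ.symm (τ l) := le_symm_of_agree hp (by simpa using hpl)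
    rw [Equiv.symm_apply_apply] at h5
    exact absurd h5 (not_lt.mpr h6)
  have hsx : (τ s : ℕ) < σ p := by
    have h1 := hun s hps (hsf.trans_le f2)
    unfold Linked at h1
    omega
  have hfs := hτ.even_odd s f (by omega) hs1 f3
  have hfp : p < σ.symm (τ f) := by
    refine lt_symm_of_agree hp (by simpa using f1.le) fun he => ?_
    rw [he] at hfs
    omega
  -- Now `τ f < τ s < σ p`, so `σ` separates this odd descent by an even letter larger than both.
  -- Being linked to `τ f`, it precedes `τ f` in `τ` too, hence also `σ p`, contrary to `hun`.
  obtain ⟨l, l1, l2, l3, l4⟩ := hσ.odd_odd p _ hfp hσp (by simpa using f3)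
    (by simpa using hfs.trans hsx)
  have h7 := (h (σ l) (τ f) (Or.inr ⟨f3, l3, (hfs.trans hsx).trans l4⟩)).mp (by simpa using l2)
  rw [Equiv.symm_apply_apply] at h7
  refine hun (τ.symm (σ l)) (le_symm_of_agree hp' (by simpa using l1.le)) (h7.trans_le f2) ?_
  rw [Equiv.apply_symm_apply]
  exact Or.inr ⟨hσp, l3, l4⟩

theorem IsBlockNormal.eq_of_sameOrder {m : ℕ} {σ τ : Equiv.Perm (Fin m)} (hσ : IsBlockNormal σ)
    (hτ : IsBlockNormal τ) (h : SameOrder Linked σ τ) : σ = τ := by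
  by_contra hne
  obtain ⟨p, hp, hpne⟩ := exists_first_difference hne
  have hp' : ∀ k < p, τ k = σ k := fun k hk => (hp k hk).symm
  rcases Nat.mod_two_eq_zero_or_one (σ p) with hx | hx <;>
    rcases Nat.mod_two_eq_zero_or_one (τ p) with hy | hy
  · rcases lt_or_gt_of_ne (Fin.val_ne_of_ne hpne) with hlt | hlt
    · exact hτ.not_odd_odd h hp hx hy hlt
    · exact hσ.not_odd_odd h.symm hp' hy hx hlt
  · exact hσ.not_odd_even hτ h hp hx hy
  · exact hτ.not_odd_even hσ h.symm hp' hy hx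
  · rcases lt_or_gt_of_ne (Fin.val_ne_of_ne hpne) with hlt | hlt
    · exact hτ.not_even_even h hp hx hy hlt
    · exact hσ.not_even_even h.symm hp' hy hx hlt

/-! ### Existence of block normal forms. -/

theorem SameOrder.of_imp {m : ℕ} {D : Fin m → Fin m → Prop} (hDs : ∀ a b, D a b → D b a)
    (hD : ∀ a b, D a b → a ≠ b) {σ τ : Equiv.Perm (Fin m)}
    (h : ∀ a b, D a b → σ.symm a < σ.symm b → τ.symm a < τ.symm b) : SameOrder D σ τ := by
  refine fun a b hab => ⟨h a b hab, fun hlt => ?_⟩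
  by_contra hcon
  have hne := σ.symm.injective.ne (hD a b hab)
  exact lt_asymm hlt (h b a (hDs a b hab) (lt_of_le_of_ne (not_lt.mp hcon) hne.symm))

open Classical in
/-- The number of the earliest block a letter can be put in, if blocks with even numbers consist of
odd letters and blocks with odd numbers consist of even letters. -/
noncomputable def level {m : ℕ} (σ : Equiv.Perm (Fin m)) (a : Fin m) : ℕ :=
  max ((a : ℕ) % 2) (Finset.univ.sup fun p : Fin m =>
    if _ : Linked p a ∧ σ.symm p < σ.symm a then level σ p + 1 else 0)
termination_by σ.symm a
decreasing_by exact And.right ‹_›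

theorem level_lt_level {m : ℕ} {σ : Equiv.Perm (Fin m)} {p a : Fin m} (hl : Linked p a)
    (hlt : σ.symm p < σ.symm a) : level σ p < level σ a := by
  classical
  rw [level.eq_1 σ a]
  refine lt_max_of_lt_right (Nat.lt_of_succ_le ?_)
  have := Finset.le_sup (f := fun p : Fin m =>
    if _ : Linked p a ∧ σ.symm p < σ.symm a then level σ p + 1 else 0) (Finset.mem_univ p)
  simpa only [dif_pos (And.intro hl hlt)] using this

theorem level_eq_or {m : ℕ} (σ : Equiv.Perm (Fin m)) (a : Fin m) :
    level σ a = (a : ℕ) % 2 ∨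
      ∃ p, Linked p a ∧ σ.symm p < σ.symm a ∧ level σ a = level σ p + 1 := by
  classical
  by_cases h : level σ a = (a : ℕ) % 2
  · exact Or.inl h
  right
  have h1 := level.eq_1 σ a
  obtain ⟨p, -, hp⟩ := Finset.exists_mem_eq_sup Finset.univ ⟨a, Finset.mem_univ a⟩
    (fun p : Fin m => if _ : Linked p a ∧ σ.symm p < σ.symm a then level σ p + 1 else 0)
  rw [hp] at h1
  split_ifs at h1 with hcond
  · refine ⟨p, hcond.1, hcond.2, ?_⟩
    omega
  · omega

theorem level_mod_two {m : ℕ} (σ : Equiv.Perm (Fin m)) (a : Fin m) :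
    level σ a % 2 = (a : ℕ) % 2 := by
  induction hk : σ.symm a using WellFoundedLT.induction generalizing a with
  | ind k ih =>
    subst hk
    rcases level_eq_or σ a with h | ⟨p, hl, hlt, h⟩
    · omega
    · have := ih _ hlt p rfl
      unfold Linked at hl
      omega

theorem exists_pred_of_two_le_level {m : ℕ} {σ : Equiv.Perm (Fin m)} {a : Fin m}
    (h : 2 ≤ level σ a) : ∃ p, Linked p a ∧ level σ a = level σ p + 1 := by
  rcases level_eq_or σ a with h' | ⟨p, hl, -, h'⟩
  · omega
  · exact ⟨p, hl, h'⟩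

/-- Levels drop by exactly one along maximizing predecessors, so none is skipped on the way down. -/
theorem exists_level_eq {m : ℕ} {σ : Equiv.Perm (Fin m)} {v : ℕ} (hv : 1 ≤ v) (d : ℕ)
    {a : Fin m} (h : level σ a = v + d) : ∃ c, level σ c = v := by
  induction d generalizing a with
  | zero => exact ⟨a, h⟩
  | succ d ih =>
    obtain ⟨p, -, hp⟩ := exists_pred_of_two_le_level (σ := σ) (a := a) (by omega)
    exact ih (a := p) (by omega)

/-- Odd letters are put in the earliest possible block that is followed by a larger even letter,
or in the last block of odd letters. -/
theorem exists_block {m : ℕ} (σ : Equiv.Perm (Fin m)) {K : ℕ} (hK : K % 2 = 0) {a : Fin m}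
    (haK : level σ a ≤ K) :
    ∃ r, r % 2 = 0 ∧ level σ a ≤ r ∧ r ≤ K ∧
      (r < K → ∃ e : Fin m, (e : ℕ) % 2 = 1 ∧ level σ e = r + 1 ∧ (a : ℕ) < e) ∧
      ∀ e : Fin m, (e : ℕ) % 2 = 1 → level σ a < level σ e → (a : ℕ) < e → r < level σ e := by
  classical
  have hex : ∃ r, r % 2 = 0 ∧ level σ a ≤ r ∧
      (r = K ∨ ∃ e : Fin m, (e : ℕ) % 2 = 1 ∧ level σ e = r + 1 ∧ (a : ℕ) < e) :=
    ⟨K, hK, haK, Or.inl rfl⟩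
  obtain ⟨h1, h2, h3⟩ := Nat.find_spec hex
  refine ⟨Nat.find hex, h1, h2, Nat.find_min' hex ⟨hK, haK, Or.inl rfl⟩,
    fun hlt => h3.resolve_left hlt.ne, fun e he hlt hae => ?_⟩
  have hpar := level_mod_two σ e
  -- Block `level σ e - 1` is itself a candidate for the minimum.
  have := Nat.find_min' hex (m := level σ e - 1)
    ⟨by omega, by omega, Or.inr ⟨e, he, by omega, hae⟩⟩
  omega

/-- Blocks are listed by number and each increases, so same-parity descents cross blocks. An even
letter beyond the first even block has a smaller odd predecessor in the block just before it; an odd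
letter not in the last odd block has a larger even letter in the next block. These letters separate
the descents. -/
theorem exists_isBlockNormal {m : ℕ} (σ : Equiv.Perm (Fin m)) :
    ∃ τ, IsBlockNormal τ ∧ SameOrder Linked σ τ := by
  classical
  set N := Finset.univ.sup (level σ) with hN
  -- The largest even number up to the maximal level: the last block available to odd letters.
  set K := 2 * (N / 2) with hKdef
  have hNle : ∀ a, level σ a ≤ N := fun a => Finset.le_sup (Finset.mem_univ a)
  have hpar := level_mod_two σ
  have hblk : ∀ a : Fin m, ∃ r, r % 2 = (a : ℕ) % 2 ∧ level σ a ≤ r ∧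
      ((a : ℕ) % 2 = 1 → r = level σ a) ∧ ((a : ℕ) % 2 = 0 → r ≤ K ∧
      (r < K → ∃ e : Fin m, (e : ℕ) % 2 = 1 ∧ level σ e = r + 1 ∧ (a : ℕ) < e) ∧
      ∀ e : Fin m, (e : ℕ) % 2 = 1 → level σ a < level σ e → (a : ℕ) < e → r < level σ e) := by
    intro a
    rcases Nat.mod_two_eq_zero_or_one a with ha | ha
    · have h1 := hNle a
      have h2 := hpar a
      obtain ⟨r, hr1, hr2, hr3⟩ := exists_block σ (K := K) (a := a) (by omega) (by omega)
      exact ⟨r, by omega, hr2, by omega, fun _ => hr3⟩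
    · exact ⟨level σ a, hpar a, le_rfl, fun _ => rfl, by omega⟩
  choose blk hmod hle heven hodd using hblk
  obtain ⟨τ, hτ⟩ := exists_perm_symm_lt_iff (fun a : Fin m => toLex (blk a, a)) (by
    intro a b hab
    simpa using congrArg (fun p => (ofLex p).2) hab)
  have hlt : ∀ a b, τ.symm a < τ.symm b ↔ blk a < blk b ∨ (blk a = blk b ∧ (a : ℕ) < b) := by
    intro a b
    rw [hτ, Prod.Lex.toLex_lt_toLex]
    rfl
  have hpos : ∀ i j, i < j ↔ blk (τ i) < blk (τ j) ∨ (blk (τ i) = blk (τ j) ∧ (τ i : ℕ) < τ j) := by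
    intro i j
    simpa using hlt (τ i) (τ j)
  have hafter : ∀ i a, i < τ.symm a ↔ blk (τ i) < blk a ∨ (blk (τ i) = blk a ∧ (τ i : ℕ) < a) := by
    intro i a
    simpa using hlt (τ i) a
  have hbefore : ∀ i a, τ.symm a < i ↔ blk a < blk (τ i) ∨ (blk a = blk (τ i) ∧ (a : ℕ) < τ i) := by
    intro i a
    simpa using hlt a (τ i)
  refine ⟨τ, ⟨?_, ?_, ?_⟩, SameOrder.of_imp (fun _ _ h => h.symm) (fun _ _ h => h.ne) ?_⟩
  · intro i j hij hi hj hji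
    have h1 := (hpos i j).mp hij
    have h2 := heven _ hi
    have h3 := heven _ hj
    have h4 := hpar (τ i)
    have h5 := hpar (τ j)
    obtain ⟨p, hl, hp⟩ := exists_pred_of_two_le_level (σ := σ) (a := τ j) (by omega)
    have hp1 : (p : ℕ) % 2 = 0 ∧ (p : ℕ) < τ j := by
      unfold Linked at hl
      omega
    have h6 := (hodd p hp1.1).2.2 (τ j) hj (by omega) hp1.2
    have h7 := hle p
    refine ⟨τ.symm p, (hafter i p).mpr (by omega), (hbefore j p).mpr (by omega), ?_, ?_⟩
    · simpa using hp1.1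
    · simpa using hp1.2
  · intro i j hij hi hj hji
    have h1 := (hpos i j).mp hij
    have h2 := hmod (τ i)
    have h3 := hmod (τ j)
    have h4 := (hodd _ hj).1
    obtain ⟨e, he1, he2, he3⟩ := (hodd _ hi).2.1 (by omega)
    have h5 := heven e he1
    refine ⟨τ.symm e, (hafter i e).mpr (by omega), (hbefore j e).mpr (by omega), ?_, ?_⟩
    · simpa using he1
    · simpa using he3
  · intro i j hij hi hj
    by_contra hcon
    have hnone : ∀ a, i < τ.symm a → τ.symm a < j → False := by
      intro a h1 h2
      rw [Fin.lt_def] at h1 h2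
      omega
    have hij' := (hpos i j).mp (by rw [Fin.lt_def]; omega)
    have h1 := heven _ hi
    have h2 := hmod (τ i)
    have h3 := hmod (τ j)
    have hjK := (hodd _ hj).1
    -- The block after that of `τ i` contains an odd letter of minimal possible level.
    obtain ⟨o, ho1, ho2, ho3⟩ : ∃ o : Fin m, (o : ℕ) % 2 = 0 ∧ level σ o = level σ (τ i) + 1 ∧
        blk o = level σ (τ i) + 1 := by
      obtain ⟨a, -, ha⟩ := Finset.exists_mem_eq_sup Finset.univ ⟨τ i, Finset.mem_univ _⟩ (level σ)
      rw [← hN] at ha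
      -- Either the next block is the last odd one, so its own level forces a letter into it, or a
      -- larger even letter one level higher does.
      rcases Nat.lt_or_ge N (level σ (τ i) + 3) with hlast | hmore
      · obtain ⟨o, ho⟩ := exists_level_eq (σ := σ) (v := level σ (τ i) + 1) (by omega)
          (N - (level σ (τ i) + 1)) (a := a) (by omega)
        have ho' := hpar o
        have ho1 : (o : ℕ) % 2 = 0 := by omega
        have h4 := (hodd o ho1).1
        have h5 := hle o
        have h6 := hmod o
        exact ⟨o, ho1, ho, by omega⟩
      · obtain ⟨e, he⟩ := exists_level_eq (σ := σ) (v := level σ (τ i) + 2) (by omega)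
          (N - (level σ (τ i) + 2)) (a := a) (by omega)
        have he' := hpar e
        obtain ⟨o, hl, ho⟩ := exists_pred_of_two_le_level (σ := σ) (a := e) (by omega)
        have ho1 : (o : ℕ) % 2 = 0 ∧ (o : ℕ) < e := by
          unfold Linked at hl
          omega
        have h4 := (hodd o ho1.1).2.2 e (by omega) (by omega) ho1.2
        have h5 := hle o
        exact ⟨o, ho1.1, by omega, by omega⟩
    obtain ⟨e, hl, he⟩ := exists_pred_of_two_le_level (σ := σ) (a := o) (by omega)
    have he1 : (e : ℕ) % 2 = 1 ∧ (o : ℕ) < e := by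
      unfold Linked at hl
      omega
    have he2 := heven e he1.1
    -- `e` shares the block of `τ i`, so adjacency of `i` and `j` makes `τ i` at least `e`. Then `o
    -- < e ≤ τ i ≤ τ j` would place `o` strictly between them.
    have hmax : (e : ℕ) ≤ τ i := by
      by_contra hgt
      exact hnone e ((hafter i e).mpr (by omega)) ((hbefore j e).mpr (by omega))
    exact hnone o ((hafter i o).mpr (by omega)) ((hbefore j o).mpr (by omega))
  · intro a b hl hab
    rw [hlt]
    have h1 := level_lt_level hl hab
    rcases hl with ⟨ha, hb, hab'⟩ | ⟨hb, ha, hab'⟩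
    · have h2 := (hodd a ha).2.2 b hb h1 hab'
      have h3 := heven b hb
      omega
    · have h2 := heven a ha
      have h3 := hle b
      omega

end ParityPattern

/-! ### The three labelings. -/

theorem theorem3p5 (n : ℕ) (hn : 1 ≤ n) :
    (∃ ΛII : ParityPattern.regions n → ParityPattern.GII n,
      ParityPattern.IsLabeling (ParityPattern.GII n) ΛII) ∧
    (∃ ΛIII : ParityPattern.regions n → ParityPattern.GIII n,
      ParityPattern.IsLabeling (ParityPattern.GIII n) ΛIII) ∧
    (∃ ΛIV : ParityPattern.regions n → ParityPattern.GIV n,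
      ParityPattern.IsLabeling (ParityPattern.GIV n) ΛIV) := by
  have hs : ∀ a b : Fin (2 * n), ParityPattern.Linked a b → ParityPattern.Linked b a :=
    fun _ _ h => h.symm
  have hne : ∀ a b : Fin (2 * n), ParityPattern.Linked a b → a ≠ b := fun _ _ h => h.ne
  refine ⟨ParityPattern.exists_isLabeling _ (fun σ => ?_) fun σ hσ τ hτ h => ?_,
    ParityPattern.exists_isLabeling _ (fun σ => ?_) fun σ hσ τ hτ h => ?_,
    ParityPattern.exists_isLabeling _ (fun σ => ?_) fun σ hσ τ hτ h => ?_⟩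
  · obtain ⟨τ, hτ, h⟩ := ParityPattern.exists_isLexNormal ParityPattern.rankII hs hne σ
    exact ⟨τ, ParityPattern.mem_GII_iff.mpr hτ, h⟩
  · exact (ParityPattern.mem_GII_iff.mp hσ).eq_of_sameOrder ParityPattern.rankII_injective
      (ParityPattern.mem_GII_iff.mp hτ) h
  · obtain ⟨τ, hτ, h⟩ := ParityPattern.exists_isLexNormal ParityPattern.rankIII hs hne σ
    exact ⟨τ, ParityPattern.mem_GIII_iff.mpr hτ, h⟩
  · exact (ParityPattern.mem_GIII_iff.mp hσ).eq_of_sameOrder ParityPattern.rankIII_injective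
      (ParityPattern.mem_GIII_iff.mp hτ) h
  · obtain ⟨τ, hτ, h⟩ := ParityPattern.exists_isBlockNormal σ
    exact ⟨τ, ParityPattern.mem_GIV_iff.mpr hτ, h⟩
  · exact (ParityPattern.mem_GIV_iff.mp hσ).eq_of_sameOrder (ParityPattern.mem_GIV_iff.mp hτ) h
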